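/- Let $m\ge 2$, $n\ge 1$, and let $\Psi\in\mathbb{C}^{m\times n}$ have columns (atoms) $\psi_1,\dots,\psi_n$ with $\|\psi_j\|_2=1$. Let $\mu(\Psi)=\max_{i\ne j}|\psi_i^H\psi_j|$ be its mutual incoherence ($0$ if $n=1$). Let $x\in\mathbb{C}^n$, $x\neq 0$, have support $S=\{i: x_i\ne 0\}$ with $|S|\le k$. Let $y=\Psi x+\mathbf n$, where $\mathbf n\sim CN(0,\sigma^2 I_m)$ with $\sigma>0$, i.e. the real and imaginary parts of the entries of $\mathbf n$ are $2m$ independent $N(0,\sigma^2/2)$ random variables. Put $$b=\sigma\sqrt{m+\tfrac12\sqrt{m\ln m}}.$$ Orthogonal matching pursuit (OMP) with input $y$ and stopping rule $\|r_i\|_2\le b$ is the following algorithm. Start with $r_0=y$, $c_0=\emptyset$. In iteration $i=1,2,\dots$ choose an index $t_i$ maximizing $|\psi_t^H r_{i-1}|$ over $t\in\{1,\dots,n\}$ (ties broken arbitrarily), put $c_i=c_{i-1}\cup\{t_i\}$ and $r_i=(I-P_i)y$, where $P_i$ is the orthogonal projection onto the span of $\{\psi_j: j\in c_i\}$; if $\|r_i\|_2\le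 b$, stop and return $c_i$, otherwise continue. Suppose that $\mu(\Psi)<\frac{1}{2k-1}$ and that every nonzero coefficient of $x$ satisfies $$|x_i|\ \ge\ \frac{2b}{1-(2k-1)\mu(\Psi)}.$$ Then, with probability at least $1-\sqrt{\frac{2}{\pi\ln m}}$, OMP with the stopping rule $\|r_i\|_2\le b$ stops and returns exactly the true support $S$, however ties are broken. -/

import Mathlib

open MeasureTheory ProbabilityTheory
open scoped NNReal Matrix

namespace ComplexOMP

noncomputable section

/-- The `j`-th atom of the dictionary `Ψ`: its `j`-th column, as a vector with the `ℓ²` norm. -/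
def atom {m n : ℕ} (Ψ : Matrix (Fin m) (Fin n) ℂ) (j : Fin n) : EuclideanSpace ℂ (Fin m) :=
  WithLp.toLp 2 (fun i => Ψ i j)

/-- The mutual incoherence of a dictionary with normalized atoms: the maximum of
`|ψᵢᴴ ψⱼ|` over `i ≠ j` (it is `0` when there is no such pair). -/
def mutualIncoherence {m n : ℕ} (Ψ : Matrix (Fin m) (Fin n) ℂ) : ℝ :=
  ⨆ p : {p : Fin n × Fin n // p.1 ≠ p.2}, ‖inner ℂ (atom Ψ p.1.1) (atom Ψ p.1.2)‖

/-- The support of a vector. -/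
def supp {n : ℕ} (x : Fin n → ℂ) : Finset (Fin n) :=
  Finset.univ.filter (fun i => x i ≠ 0)

/-- The noisy measurement `Ψ x + e`. -/
def measurement {m n : ℕ} (Ψ : Matrix (Fin m) (Fin n) ℂ) (x : Fin n → ℂ)
    (e : EuclideanSpace ℂ (Fin m)) : EuclideanSpace ℂ (Fin m) :=
  WithLp.toLp 2 (Ψ *ᵥ x) + e

/-- The residual `(I - P) y`, with `P` the orthogonal projection onto the span of the atoms
selected in `c`. -/
def residual {m n : ℕ} (Ψ : Matrix (Fin m) (Fin n) ℂ) (y : EuclideanSpace ℂ (Fin m))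
    (c : Finset (Fin n)) : EuclideanSpace ℂ (Fin m) :=
  y - (Submodule.span ℂ (atom Ψ '' (c : Set (Fin n)))).starProjection y

/-- The set of indices selected in the first `i` iterations, when `t i` is the index chosen in
iteration `i + 1`. -/
def selected {n : ℕ} (t : ℕ → Fin n) (i : ℕ) : Finset (Fin n) :=
  (Finset.range i).image t

/-- `t` is a possible sequence of choices of orthogonal matching pursuit on the input `y`: the
index `t i` chosen in iteration `i + 1` maximizes the correlation of the atom with the current
residual (ties may be broken in any way). -/
def IsGreedy {m n : ℕ} (Ψ : Matrix (Fin m) (Fin n) ℂ) (y : EuclideanSpace ℂ (Fin m))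
    (t : ℕ → Fin n) : Prop :=
  ∀ i : ℕ, ∀ j : Fin n,
    ‖inner ℂ (atom Ψ j) (residual Ψ y (selected t i))‖ ≤
      ‖inner ℂ (atom Ψ (t i)) (residual Ψ y (selected t i))‖

/-- With the stopping rule `‖rᵢ‖ ≤ ε`, which is checked at the end of each iteration, the algorithm
making the choices `t` stops after exactly `N` iterations. -/
def StopsAfter {m n : ℕ} (Ψ : Matrix (Fin m) (Fin n) ℂ) (y : EuclideanSpace ℂ (Fin m)) (ε : ℝ)
    (t : ℕ → Fin n) (N : ℕ) : Prop :=
  1 ≤ N ∧ ‖residual Ψ y (selected t N)‖ ≤ ε ∧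
    ∀ i : ℕ, 1 ≤ i → i < N → ¬ ‖residual Ψ y (selected t i)‖ ≤ ε

/-- Orthogonal matching pursuit on the input `y` with the stopping rule `‖rᵢ‖ ≤ ε` selects
exactly the set `S`: however ties are broken, it stops, and the set selected then is `S`. -/
def OMPSelects {m n : ℕ} (Ψ : Matrix (Fin m) (Fin n) ℂ) (y : EuclideanSpace ℂ (Fin m)) (ε : ℝ)
    (S : Finset (Fin n)) : Prop :=
  ∀ t : ℕ → Fin n, IsGreedy Ψ y t → ∃ N : ℕ, StopsAfter Ψ y ε t N ∧ selected t N = S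

/-- The law `CN(0, v)` on `ℂ`: the law of `X + iY` with `X`, `Y` independent `N(0, v / 2)`. -/
def complexGaussian (v : ℝ≥0) : Measure ℂ :=
  ((gaussianReal 0 (v / 2)).prod (gaussianReal 0 (v / 2))).map
    (fun p : ℝ × ℝ => (⟨p.1, p.2⟩ : ℂ))

/-- The law `CN(0, v I)` on `ℂᵐ`: the coordinates are independent with law `CN(0, v)`. -/
def complexGaussianVector (m : ℕ) (v : ℝ≥0) : Measure (EuclideanSpace ℂ (Fin m)) :=
  (Measure.pi (fun _ : Fin m => complexGaussian v)).map (WithLp.toLp 2)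

/-- The noise level `σ √(m + ½ √(m ln m))`. -/
def threshold (m : ℕ) (σ : ℝ) : ℝ :=
  σ * √((m : ℝ) + 1 / 2 * √((m : ℝ) * Real.log (m : ℝ)))

end

end ComplexOMP

/-! The claim splits into a deterministic statement on the event ‖noise‖ < b and a tail bound for
its complement.

Deterministic (`exists_mem_supp_correlation`): while c ⊂ S, the residual is ∑ a_j ψ_j over S plus
projected noise, and a_j = x_j off c. Let M = max |a_j|, attained at i. Incoherence gives
correlation more than M - (k-1)Mμ - b at i and less than kMμ + b off S. Since M(1 - (2k-1)μ) ≥ 2b,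
every greedy choice lies in S. The same bound puts the correlation at i above b, so no atom repeats
and the algorithm does not stop before S is exhausted. Then only projected noise is left, and it
stops.

Probabilistic: ‖noise‖²/σ² is a sum of m independent standard exponentials, so its tail at a is
e^{-a} ∑_{j<m} a^j/j!. With a = m + u, telescoping bounds this by (m/u) e^{-a} a^m/m!, and Stirling
by (m/u)/√(2πm). For u = ½√(m ln m) this is √(2/(π ln m)). -/

namespace ComplexOMP

/-! ### Greedy selection under bounded noise -/

section Deterministic

variable {m n : ℕ} {Ψ : Matrix (Fin m) (Fin n) ℂ}

lemma norm_inner_atom_le_mutualIncoherence {i j : Fin n} (h : i ≠ j) :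
    ‖inner ℂ (atom Ψ i) (atom Ψ j)‖ ≤ mutualIncoherence Ψ :=
  le_ciSup (f := fun p : {p : Fin n × Fin n // p.1 ≠ p.2} =>
    ‖inner ℂ (atom Ψ p.1.1) (atom Ψ p.1.2)‖) (Set.finite_range _).bddAbove ⟨(i, j), h⟩

lemma mutualIncoherence_nonneg : 0 ≤ mutualIncoherence Ψ :=
  Real.iSup_nonneg fun _ => norm_nonneg _

lemma inner_atom_sum (S : Finset (Fin n)) (a : Fin n → ℂ) (i : Fin n) :
    inner ℂ (atom Ψ i) (∑ j ∈ S, a j • atom Ψ j) =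
      ∑ j ∈ S, a j * inner ℂ (atom Ψ i) (atom Ψ j) := by
  simp only [inner_sum, inner_smul_right]

lemma norm_sum_mul_inner_atom_le {T : Finset (Fin n)} {a : Fin n → ℂ} {M : ℝ}
    (hM : ∀ j ∈ T, ‖a j‖ ≤ M) {i : Fin n} (hi : i ∉ T) :
    ‖∑ j ∈ T, a j * inner ℂ (atom Ψ i) (atom Ψ j)‖ ≤ T.card * (M * mutualIncoherence Ψ) := by
  refine (norm_sum_le_of_le T (f := fun j => a j * inner ℂ (atom Ψ i) (atom Ψ j))
    (n := fun _ => M * mutualIncoherence Ψ) fun j hj => ?_).trans (by simp)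
  rw [norm_mul]
  exact mul_le_mul (hM j hj)
    (norm_inner_atom_le_mutualIncoherence fun h => hi (h ▸ hj)) (norm_nonneg _)
    ((norm_nonneg _).trans (hM j hj))

/-- Diagonal dominance of the Gram matrix: the diagonal entry is 1, and each of the other |S| - 1
terms has size at most Mμ. -/
lemma le_norm_inner_atom_sum (hΨ : ∀ j, ‖atom Ψ j‖ = 1) {S : Finset (Fin n)} {a : Fin n → ℂ}
    {M : ℝ} (hM : ∀ j ∈ S, ‖a j‖ ≤ M) {i : Fin n} (hi : i ∈ S) :
    ‖a i‖ - (S.card - 1) * (M * mutualIncoherence Ψ) ≤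
      ‖inner ℂ (atom Ψ i) (∑ j ∈ S, a j • atom Ψ j)‖ := by
  have hself : inner ℂ (atom Ψ i) (atom Ψ i) = (1 : ℂ) := by
    simp [inner_self_eq_norm_sq_to_K, hΨ i]
  rw [inner_atom_sum, ← Finset.add_sum_erase S _ hi, hself, mul_one]
  have h1 := norm_sum_mul_inner_atom_le (Ψ := Ψ) (T := S.erase i) (a := a)
    (fun j hj => hM j (Finset.mem_of_mem_erase hj)) (Finset.notMem_erase i S)
  rw [Finset.cast_card_erase_of_mem hi] at h1
  have h2 := norm_sub_le_norm_add (a i)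
    (∑ j ∈ S.erase i, a j * inner ℂ (atom Ψ i) (atom Ψ j))
  linarith

lemma residual_add (y z : EuclideanSpace ℂ (Fin m)) (c : Finset (Fin n)) :
    residual Ψ (y + z) c = residual Ψ y c + residual Ψ z c := by
  simp only [residual, map_add]
  abel

lemma residual_eq_starProjection_orthogonal (y : EuclideanSpace ℂ (Fin m)) (c : Finset (Fin n)) :
    residual Ψ y c = (Submodule.span ℂ (atom Ψ '' (c : Set (Fin n))))ᗮ.starProjection y := by
  rw [Submodule.starProjection_orthogonal_val, residual]

lemma norm_residual_le (y : EuclideanSpace ℂ (Fin m)) (c : Finset (Fin n)) :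
    ‖residual Ψ y c‖ ≤ ‖y‖ := by
  rw [residual_eq_starProjection_orthogonal]
  exact Submodule.norm_starProjection_apply_le _ _

lemma inner_atom_residual_eq_zero (y : EuclideanSpace ℂ (Fin m)) {c : Finset (Fin n)} {j : Fin n}
    (hj : j ∈ c) : inner ℂ (atom Ψ j) (residual Ψ y c) = 0 := by
  rw [residual_eq_starProjection_orthogonal]
  exact Submodule.inner_right_of_mem_orthogonal
    (Submodule.subset_span (Set.mem_image_of_mem _ (Finset.mem_coe.2 hj)))
    (Submodule.starProjection_apply_mem _ _)

lemma residual_eq_zero {y : EuclideanSpace ℂ (Fin m)} {c : Finset (Fin n)}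
    (hy : y ∈ Submodule.span ℂ (atom Ψ '' (c : Set (Fin n)))) : residual Ψ y c = 0 := by
  rw [residual, Submodule.starProjection_eq_self_iff.2 hy, sub_self]

lemma norm_inner_atom_le (hΨ : ∀ j, ‖atom Ψ j‖ = 1) (j : Fin n) (y : EuclideanSpace ℂ (Fin m)) :
    ‖inner ℂ (atom Ψ j) y‖ ≤ ‖y‖ := by
  simpa [hΨ j] using norm_inner_le_norm (𝕜 := ℂ) (atom Ψ j) y

lemma toLp_mulVec_eq_sum (x : Fin n → ℂ) :
    (WithLp.toLp 2 (Ψ *ᵥ x) : EuclideanSpace ℂ (Fin m)) = ∑ j ∈ supp x, x j • atom Ψ j := by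
  have h : ∑ j ∈ supp x, x j • atom Ψ j = ∑ j, x j • atom Ψ j :=
    Finset.sum_filter_of_ne fun j _ h hj => h (by simp [hj])
  rw [h]
  ext i
  simp [Matrix.mulVec, dotProduct, atom, mul_comm]

/-- The projection is a combination of the atoms in c, so subtracting it changes only coefficients
indexed by c; unselected ones keep their size. -/
lemma exists_residual_eq_sum (x : Fin n → ℂ) {c : Finset (Fin n)} (hc : c ⊆ supp x) :
    ∃ a : Fin n → ℂ, (∀ j ∉ c, a j = x j) ∧
      residual Ψ (WithLp.toLp 2 (Ψ *ᵥ x)) c = ∑ j ∈ supp x, a j • atom Ψ j := by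
  obtain ⟨d, hd⟩ := (Submodule.mem_span_image_finset_iff_exists_fun' ℂ).1
    (Submodule.starProjection_apply_mem (Submodule.span ℂ (atom Ψ '' (c : Set (Fin n))))
      (WithLp.toLp 2 (Ψ *ᵥ x)))
  refine ⟨fun j => x j - if j ∈ c then d j else 0, fun j hj => by simp [hj], ?_⟩
  rw [residual, ← hd, toLp_mulVec_eq_sum]
  simp only [sub_smul, ite_smul, zero_smul, Finset.sum_sub_distrib, Finset.sum_ite_mem]
  rw [Finset.inter_eq_right.2 hc]

/-- As long as a proper subset of the support is selected, some atom of the support is correlated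
with the residual more than the noise level, and more than every atom off the support. -/
lemma exists_mem_supp_correlation (hΨ : ∀ j, ‖atom Ψ j‖ = 1) {x : Fin n → ℂ} {k : ℕ}
    (hk : (supp x).card ≤ k) {b : ℝ} {e : EuclideanSpace ℂ (Fin m)} (he : ‖e‖ < b)
    (hμ : mutualIncoherence Ψ < 1 / (2 * (k : ℝ) - 1))
    (hcoef : ∀ i, x i ≠ 0 → 2 * b / (1 - (2 * (k : ℝ) - 1) * mutualIncoherence Ψ) ≤ ‖x i‖)
    {c : Finset (Fin n)} (hc : c ⊂ supp x) :
    ∃ i, b < ‖inner ℂ (atom Ψ i) (residual Ψ (measurement Ψ x e) c)‖ ∧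
      ∀ t ∉ supp x, ‖inner ℂ (atom Ψ t) (residual Ψ (measurement Ψ x e) c)‖ <
        ‖inner ℂ (atom Ψ i) (residual Ψ (measurement Ψ x e) c)‖ := by
  obtain ⟨l, hlS, hlc⟩ := Finset.exists_of_ssubset hc
  obtain ⟨a, hac, hs⟩ := exists_residual_eq_sum (Ψ := Ψ) x hc.subset
  -- The maximum is taken over all of S; the unselected l only serves to bound it below by |x_l|.
  obtain ⟨i, hiS, hi⟩ := Finset.exists_max_image (supp x) (fun j => ‖a j‖) ⟨l, hlS⟩
  have hμ0 := mutualIncoherence_nonneg (Ψ := Ψ)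
  have hSk : ((supp x).card : ℝ) ≤ k := by exact_mod_cast hk
  have hk1 : (1 : ℝ) ≤ k := by
    exact_mod_cast (Finset.card_pos.2 ⟨l, hlS⟩).trans_le hk
  have hD : 0 < 1 - (2 * (k : ℝ) - 1) * mutualIncoherence Ψ := by
    rw [lt_div_iff₀ (by linarith)] at hμ
    linarith
  have hM : 2 * b ≤ ‖a i‖ * (1 - (2 * (k : ℝ) - 1) * mutualIncoherence Ψ) := by
    rw [← div_le_iff₀ hD]
    refine (hcoef l (by simpa [supp] using hlS)).trans ?_
    rw [← hac l hlc]
    exact hi l hlS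
  have hMμ : 0 ≤ ‖a i‖ * mutualIncoherence Ψ := by positivity
  have hr : ∀ t, inner ℂ (atom Ψ t) (residual Ψ (measurement Ψ x e) c) =
      inner ℂ (atom Ψ t) (∑ j ∈ supp x, a j • atom Ψ j) + inner ℂ (atom Ψ t) (residual Ψ e c) :=
    fun t => by rw [measurement, residual_add, inner_add_right, hs]
  -- Strict because `he` is; this is what makes both conclusions strict even when the coefficient
  -- bound is an equality.
  have hnoise : ∀ t, ‖inner ℂ (atom Ψ t) (residual Ψ e c)‖ < b := fun t =>
    ((norm_inner_atom_le hΨ t _).trans (norm_residual_le e c)).trans_lt he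
  have hlow : ‖a i‖ - (k - 1) * (‖a i‖ * mutualIncoherence Ψ) - b <
      ‖inner ℂ (atom Ψ i) (residual Ψ (measurement Ψ x e) c)‖ := by
    have h1 := le_norm_inner_atom_sum hΨ hi hiS
    have h2 := norm_sub_le_norm_add (inner ℂ (atom Ψ i) (∑ j ∈ supp x, a j • atom Ψ j))
      (inner ℂ (atom Ψ i) (residual Ψ e c))
    have h3 := mul_le_mul_of_nonneg_right hSk hMμ
    rw [hr]
    linarith [hnoise i]
  have hkMμ : 0 ≤ (k : ℝ) * (‖a i‖ * mutualIncoherence Ψ) := by positivity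
  refine ⟨i, by linarith, fun t ht => ?_⟩
  have h1 := norm_sum_mul_inner_atom_le (Ψ := Ψ) hi ht
  have h2 := mul_le_mul_of_nonneg_right hSk hMμ
  have h3 := norm_add_le (inner ℂ (atom Ψ t) (∑ j ∈ supp x, a j • atom Ψ j))
      (inner ℂ (atom Ψ t) (residual Ψ e c))
  rw [← inner_atom_sum] at h1
  rw [← hr] at h3
  linarith [hnoise t]

/-- Orthogonal matching pursuit recovers the support when the noise is below the threshold of the
stopping rule. -/
theorem ompSelects_supp_of_norm_lt (hΨ : ∀ j, ‖atom Ψ j‖ = 1) {x : Fin n → ℂ} (hx : x ≠ 0) {k : ℕ}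
    (hk : (supp x).card ≤ k) {b : ℝ} {e : EuclideanSpace ℂ (Fin m)} (he : ‖e‖ < b)
    (hμ : mutualIncoherence Ψ < 1 / (2 * (k : ℝ) - 1))
    (hcoef : ∀ i, x i ≠ 0 → 2 * b / (1 - (2 * (k : ℝ) - 1) * mutualIncoherence Ψ) ≤ ‖x i‖) :
    OMPSelects Ψ (measurement Ψ x e) b (supp x) := by
  intro t ht
  have hb : 0 < b := (norm_nonneg e).trans_lt he
  have hgap := fun c => exists_mem_supp_correlation hΨ hk he hμ hcoef (c := c)
  have hsel : ∀ i, i ≤ (supp x).card → selected t i ⊆ supp x ∧ (selected t i).card = i := by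
    intro i
    induction i with
    | zero => simp [selected]
    | succ i ih =>
      intro hi
      obtain ⟨hsub, hcard⟩ := ih (by omega)
      obtain ⟨l, hl, hoff⟩ := hgap _ (hsub.ssubset_of_ne fun h => by rw [h] at hcard; omega)
      have hS : t i ∈ supp x := by
        by_contra h
        exact ((ht i l).trans_lt (hoff _ h)).false
      -- The residual is orthogonal to selected atoms, whereas the maximal correlation exceeds b >
      -- 0.
      have hnew : t i ∉ selected t i := by
        intro h
        have := ht i l
        rw [inner_atom_residual_eq_zero _ h, norm_zero] at this
        linarith
      have hsucc : selected t (i + 1) = insert (t i) (selected t i) := by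
        simp [selected, Finset.range_add_one]
      rw [hsucc, Finset.card_insert_of_notMem hnew, hcard]
      exact ⟨Finset.insert_subset hS hsub, rfl⟩
  obtain ⟨hsub, hcard⟩ := hsel _ le_rfl
  have hfull : selected t (supp x).card = supp x := Finset.eq_of_subset_of_card_le hsub hcard.ge
  refine ⟨(supp x).card, ⟨?_, ?_, fun i _ hi hle => ?_⟩, hfull⟩
  -- The rule is first checked after one iteration, so the support must be nonempty.
  · obtain ⟨l, hl⟩ := Function.ne_iff.1 hx
    exact Finset.card_pos.2 ⟨l, by simpa [supp] using hl⟩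
  · rw [hfull, measurement, residual_add, residual_eq_zero, zero_add]
    · exact (norm_residual_le _ _).trans he.le
    · rw [toLp_mulVec_eq_sum]
      exact Submodule.sum_mem _ fun j hj => Submodule.smul_mem _ _
        (Submodule.subset_span (Set.mem_image_of_mem _ (Finset.mem_coe.2 hj)))
  -- Correlation with a unit vector bounds the residual norm from below, which excludes an early
  -- stop.
  · obtain ⟨hsub, hcard⟩ := hsel i hi.le
    obtain ⟨l, hl, -⟩ := hgap _ (hsub.ssubset_of_ne fun h => by rw [h] at hcard; omega)
    exact (hl.trans_le (norm_inner_atom_le hΨ l _)).not_ge hle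

end Deterministic

/-! ### Estimate of the Erlang tail -/

section Tail

/-- An upper bound for a partial sum of the exponential series at a point beyond its length. -/
lemma sum_pow_div_factorial_mul_sub_le {a : ℝ} (ha : 0 ≤ a) (m : ℕ) :
    (∑ j ∈ Finset.range m, a ^ j / j.factorial) * (a - m) ≤ m * (a ^ m / m.factorial) := by
  -- Each term equals (j+1) a^(j+1)/(j+1)! - j a^j/j!, so the sum telescopes. Replacing a - j by the
  -- smaller a - m then gives the bound.
  have htel : ∑ j ∈ Finset.range m, a ^ j / j.factorial * (a - j) = m * (a ^ m / m.factorial) := by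
    induction m with
    | zero => simp
    | succ m ih =>
      rw [Finset.sum_range_succ, ih, Nat.factorial_succ]
      push_cast
      field_simp
      ring
  rw [← htel, Finset.sum_mul]
  refine Finset.sum_le_sum fun j hj => mul_le_mul_of_nonneg_left ?_ (by positivity)
  have : (j : ℝ) ≤ m := by exact_mod_cast (Finset.mem_range.1 hj).le
  linarith

/-- From 1 + u/m ≤ e^{u/m} one gets (m+u)^m ≤ m^m e^u, leaving (m/e)^m/m!, to which Stirling's lower
bound for m! applies. -/
lemma exp_neg_mul_pow_div_factorial_le {m : ℕ} (hm : 1 ≤ m) {u : ℝ} (hu : 0 ≤ u) :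
    Real.exp (-(m + u)) * ((m + u) ^ m / m.factorial) ≤ 1 / √(2 * Real.pi * m) := by
  have hm0 : (0 : ℝ) < m := by exact_mod_cast hm
  have hst := Stirling.le_factorial_stirling m
  rw [mul_div_assoc', div_le_div_iff₀ (by positivity) (by positivity), one_mul]
  refine le_trans ?_ hst
  rw [mul_comm]
  refine mul_le_mul_of_nonneg_left ?_ (by positivity)
  have h1 : (m + u) ^ m ≤ m ^ m * Real.exp u := by
    have h := pow_le_pow_left₀ (by positivity) (Real.add_one_le_exp (u / m)) m
    rw [← Real.exp_nat_mul, mul_div_cancel₀ _ hm0.ne'] at h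
    calc ((m : ℝ) + u) ^ m = m ^ m * (u / m + 1) ^ m := by
          rw [← mul_pow]; congr 1; field_simp; rw [add_comm]
      _ ≤ _ := by gcongr
  calc Real.exp (-(m + u)) * (m + u) ^ m ≤ Real.exp (-(m + u)) * (m ^ m * Real.exp u) := by gcongr
    _ = m ^ m * (Real.exp (-(m + u)) * Real.exp u) := by ring
    _ = (m / Real.exp 1) ^ m := by
      rw [← Real.exp_add, div_pow, ← Real.exp_nat_mul, mul_one, div_eq_mul_inv, ← Real.exp_neg]
      congr 2
      ring

lemma exp_neg_mul_sum_le {m : ℕ} (hm : 2 ≤ m) {a : ℝ}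
    (ha : a = m + 1 / 2 * √(m * Real.log m)) :
    Real.exp (-a) * ∑ j ∈ Finset.range m, a ^ j / j.factorial ≤
      √(2 / (Real.pi * Real.log m)) := by
  have hm0 : (0 : ℝ) < m := by positivity
  have hlog : 0 < Real.log m := Real.log_pos (by exact_mod_cast hm)
  set u := 1 / 2 * √(m * Real.log m) with hu
  have hu0 : 0 < u := by positivity
  have ha0 : 0 ≤ a := by rw [ha]; positivity
  have h1 := sum_pow_div_factorial_mul_sub_le ha0 m
  have h2 := exp_neg_mul_pow_div_factorial_le (m := m) (by omega) hu0.le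
  have hau : a - m = u := by rw [ha]; ring
  rw [← ha] at h2
  rw [hau, ← le_div_iff₀ hu0] at h1
  calc _ ≤ Real.exp (-a) * (m * (a ^ m / m.factorial) / u) := by gcongr
    _ = m / u * (Real.exp (-a) * (a ^ m / m.factorial)) := by ring
    _ ≤ m / u * (1 / √(2 * Real.pi * m)) := by gcongr
    _ = √(2 / (Real.pi * Real.log m)) := by
      rw [eq_comm, Real.sqrt_eq_iff_eq_sq (by positivity) (by positivity), hu, mul_pow, div_pow,
        div_pow, mul_pow, Real.sq_sqrt (by positivity), Real.sq_sqrt (by positivity)]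
      field_simp

end Tail

/-! ### Law of the squared norm of complex Gaussian noise -/

section Gaussian

open Real Set

instance (v : ℝ≥0) : IsProbabilityMeasure (complexGaussian v) :=
  Measure.isProbabilityMeasure_map (Measurable.aemeasurable (by
    exact Complex.measurableEquivRealProd.symm.measurable))

lemma lintegral_Ioi_mul_exp_neg_sq_div {v : ℝ} (hv : 0 < v) {R : ℝ} (hR : 0 ≤ R) :
    ∫⁻ r in Ioi R, ENNReal.ofReal (r * (2 / v * exp (-(r ^ 2 / v)))) =
      ENNReal.ofReal (exp (-(R ^ 2 / v))) := by
  have hderiv : ∀ r ∈ Ici R, HasDerivAt (fun r => -exp (-(r ^ 2 / v)))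
      (r * (2 / v * exp (-(r ^ 2 / v)))) r := by
    intro r _
    refine ((((hasDerivAt_pow 2 r).div_const v).fun_neg.exp).fun_neg).congr_deriv ?_
    push_cast
    ring
  have hnonneg : ∀ r ∈ Ioi R, 0 ≤ r * (2 / v * exp (-(r ^ 2 / v))) := by
    intro r hr
    have : 0 < r := hR.trans_lt hr
    positivity
  have hlim : Filter.Tendsto (fun r => -exp (-(r ^ 2 / v))) Filter.atTop (nhds (-0)) :=
    (tendsto_exp_neg_atTop_nhds_zero.comp
      ((Filter.tendsto_pow_atTop two_ne_zero).atTop_div_const hv)).neg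
  rw [← ofReal_integral_eq_lintegral_ofReal
      (integrableOn_Ioi_deriv_of_nonneg' hderiv hnonneg hlim)
      ((ae_restrict_iff' measurableSet_Ioi).2 (Filter.Eventually.of_forall hnonneg)),
    integral_Ioi_of_hasDerivAt_of_nonneg' hderiv hnonneg hlim]
  simp

lemma gaussianPDF_mul_gaussianPDF {v : ℝ≥0} (x y : ℝ) :
    gaussianPDF 0 (v / 2) x * gaussianPDF 0 (v / 2) y =
      ENNReal.ofReal (1 / (π * v) * exp (-((x ^ 2 + y ^ 2) / v))) := by
  rw [gaussianPDF, gaussianPDF, ← ENNReal.ofReal_mul (gaussianPDFReal_nonneg _ _ _),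
    gaussianPDFReal, gaussianPDFReal]
  congr 1
  have h : √(2 * π * ((v / 2 : ℝ≥0) : ℝ)) * √(2 * π * ((v / 2 : ℝ≥0) : ℝ)) = π * v := by
    rw [mul_self_sqrt (by positivity)]
    push_cast
    ring
  rw [mul_mul_mul_comm, ← mul_inv, h, ← exp_add]
  push_cast
  ring_nf

/-- In polar coordinates the joint density is radial, and the Jacobian r makes the radial integral
elementary. -/
lemma complexGaussian_lt_normSq {v : ℝ≥0} (hv : v ≠ 0) {s : ℝ} (hs : 0 ≤ s) :
    complexGaussian v {z | s < ‖z‖ ^ 2 / v} = ENNReal.ofReal (exp (-s)) := by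
  have hv0 : (0 : ℝ) < v := by positivity
  have hmeas : Measurable (fun p : ℝ × ℝ => (⟨p.1, p.2⟩ : ℂ)) :=
    Complex.measurableEquivRealProd.symm.measurable
  have hv2 : v / 2 ≠ 0 := by positivity
  have hset : MeasurableSet {p : ℝ × ℝ | s < (p.1 ^ 2 + p.2 ^ 2) / v} :=
    measurableSet_lt measurable_const (by fun_prop)
  have hpre : (fun p : ℝ × ℝ => (⟨p.1, p.2⟩ : ℂ)) ⁻¹' {z | s < ‖z‖ ^ 2 / v} =
      {p : ℝ × ℝ | s < (p.1 ^ 2 + p.2 ^ 2) / v} := by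
    ext p
    simp only [mem_preimage, mem_ofPred_eq, Complex.sq_norm, Complex.normSq_mk, ← sq]
  rw [complexGaussian, Measure.map_apply hmeas (measurableSet_lt measurable_const (by fun_prop)),
    hpre, gaussianReal_of_var_ne_zero _ hv2,
    prod_withDensity (measurable_gaussianPDF _ _) (measurable_gaussianPDF _ _),
    withDensity_apply _ hset, ← lintegral_indicator hset, ← Measure.volume_eq_prod,
    ← lintegral_comp_polarCoord_symm]
  have hsqrt : 0 ≤ √(s * v) := sqrt_nonneg _
  -- The constant angular factor is 1/(2π), the uniform density on (-π, π), so that the radial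
  -- factor is itself a probability density.
  have hmain : ∀ p ∈ polarCoord.target, ENNReal.ofReal p.1 •
      {p : ℝ × ℝ | s < (p.1 ^ 2 + p.2 ^ 2) / v}.indicator
        (fun z => gaussianPDF 0 (v / 2) z.1 * gaussianPDF 0 (v / 2) z.2) (polarCoord.symm p) =
      (Ioi √(s * v)).indicator
        (fun r => ENNReal.ofReal (r * (2 / v * exp (-(r ^ 2 / v))))) p.1 *
        ENNReal.ofReal (1 / (2 * π)) := by
    rintro ⟨r, θ⟩ ⟨hr, -⟩
    have hr : 0 < r := hr
    have hsq : (r * cos θ) ^ 2 + (r * sin θ) ^ 2 = r ^ 2 := by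
      rw [mul_pow, mul_pow, ← mul_add, cos_sq_add_sin_sq, mul_one]
    simp only [polarCoord_symm_apply, indicator_apply, mem_ofPred_eq, hsq, mem_Ioi,
      gaussianPDF_mul_gaussianPDF, lt_div_iff₀ hv0, sqrt_lt' hr]
    split_ifs
    · rw [smul_eq_mul, ← ENNReal.ofReal_mul hr.le, ← ENNReal.ofReal_mul (by positivity)]
      congr 1
      field_simp
    · simp
  rw [setLIntegral_congr_fun polarCoord.open_target.measurableSet hmain, polarCoord_target,
    Measure.volume_eq_prod, ← Measure.prod_restrict,
    lintegral_prod_mul (f := (Ioi √(s * v)).indicator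
      fun r => ENNReal.ofReal (r * (2 / v * exp (-(r ^ 2 / v)))))
      (g := fun _ => ENNReal.ofReal (1 / (2 * π)))
      ((Measurable.indicator (by fun_prop) measurableSet_Ioi).aemeasurable) (by fun_prop),
    lintegral_indicator measurableSet_Ioi, Measure.restrict_restrict measurableSet_Ioi,
    inter_eq_left.2 (Ioi_subset_Ioi hsqrt), lintegral_Ioi_mul_exp_neg_sq_div hv0 hsqrt,
    sq_sqrt (by positivity), mul_div_cancel_right₀ _ hv0.ne', lintegral_const,
    Measure.restrict_apply_univ, volume_Ioo, ← ENNReal.ofReal_mul (by positivity),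
    ← ENNReal.ofReal_mul (exp_pos _).le]
  congr 1
  field_simp
  ring

/-- The squared modulus of a complex Gaussian variable is exponentially distributed. -/
lemma map_complexGaussian_normSq {v : ℝ≥0} (hv : v ≠ 0) :
    (complexGaussian v).map (fun z => ‖z‖ ^ 2 / v) = expMeasure 1 := by
  have hmeas : Measurable fun z : ℂ => ‖z‖ ^ 2 / (v : ℝ) := by fun_prop
  have := isProbabilityMeasure_expMeasure one_pos
  have := Measure.isProbabilityMeasure_map (μ := complexGaussian v) hmeas.aemeasurable
  refine Measure.eq_of_cdf _ _ ?_
  ext s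
  rw [cdf_expMeasure_eq one_pos, cdf_eq_real, map_measureReal_apply hmeas measurableSet_Iic]
  split_ifs with h
  · have hc : (fun z : ℂ => ‖z‖ ^ 2 / (v : ℝ)) ⁻¹' Iic s = {z | s < ‖z‖ ^ 2 / v}ᶜ := by
      ext z; simp
    rw [hc, probReal_compl_eq_one_sub (measurableSet_lt measurable_const hmeas), measureReal_def,
      complexGaussian_lt_normSq hv h, ENNReal.toReal_ofReal (exp_pos _).le, one_mul]
  · have hc : (fun z : ℂ => ‖z‖ ^ 2 / (v : ℝ)) ⁻¹' Iic s = ∅ := by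
      ext z
      have : 0 ≤ ‖z‖ ^ 2 / (v : ℝ) := by positivity
      simp only [mem_preimage, mem_Iic, mem_empty_iff_false, iff_false]
      linarith
    rw [hc, measureReal_empty]

/-- Induction step for the Erlang tail: if G is the tail of a sum of m standard exponentials, the
integral is the tail after adding one more independent one. -/
lemma lintegral_expMeasure_tail {m : ℕ} {G : ℝ → ENNReal} {s : ℝ} (hs : 0 ≤ s)
    (hneg : ∀ u < 0, G u = 1)
    (hnonneg : ∀ u, 0 ≤ u → G u =
      ENNReal.ofReal (exp (-u) * ∑ j ∈ Finset.range m, u ^ j / j.factorial)) :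
    ∫⁻ t, G (s - t) ∂(expMeasure 1) =
      ENNReal.ofReal (exp (-s) * ∑ j ∈ Finset.range (m + 1), s ^ j / j.factorial) := by
  have := isProbabilityMeasure_expMeasure one_pos
  have hIoi : expMeasure 1 (Ioi s) = ENNReal.ofReal (exp (-s)) := by
    rw [← compl_Iic, ← ofReal_measureReal, probReal_compl_eq_one_sub measurableSet_Iic,
      ← cdf_eq_real, cdf_expMeasure_eq one_pos, if_pos hs]
    simp
  -- The density e^{-t} and the factor e^{-(s-t)} multiply to e^{-s}, so only a polynomial is
  -- integrated and each degree rises by one.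
  have hpoly : ∫ t in (0 : ℝ)..s, exp (-s) * ∑ j ∈ Finset.range m, (s - t) ^ j / j.factorial =
      exp (-s) * ∑ j ∈ Finset.range m, s ^ (j + 1) / (j + 1).factorial := by
    rw [intervalIntegral.integral_const_mul, intervalIntegral.integral_finsetSum
      (fun j _ => Continuous.intervalIntegrable (by fun_prop) _ _)]
    congr 1
    refine Finset.sum_congr rfl fun j _ => ?_
    rw [intervalIntegral.integral_div, intervalIntegral.integral_comp_sub_left (fun t => t ^ j),
      sub_self, sub_zero, integral_pow, Nat.factorial_succ]
    push_cast
    field_simp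
    simp
  have hIic : ∫⁻ t in Iic s, G (s - t) ∂(expMeasure 1) =
      ENNReal.ofReal (exp (-s) * ∑ j ∈ Finset.range m, s ^ (j + 1) / (j + 1).factorial) := by
    rw [setLIntegral_congr_fun measurableSet_Iic (g := fun t => ENNReal.ofReal
      (exp (-(s - t)) * ∑ j ∈ Finset.range m, (s - t) ^ j / j.factorial))
      (fun t ht => hnonneg _ (sub_nonneg.2 ht)), expMeasure, gammaMeasure,
      setLIntegral_withDensity_eq_setLIntegral_mul _
        (f := gammaPDF 1 1) (measurable_gammaPDFReal 1 1).ennreal_ofReal (by fun_prop) measurableSet_Iic,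
      lintegral_Iic_eq_lintegral_Iio_add_Icc _ hs,
      setLIntegral_congr_fun measurableSet_Iio (g := fun _ => 0)
        (fun t ht => by simp [gammaPDF_of_neg ht]), lintegral_zero, zero_add,
      setLIntegral_congr_fun measurableSet_Icc (g := fun t => ENNReal.ofReal
        (exp (-s) * ∑ j ∈ Finset.range m, (s - t) ^ j / j.factorial)), ← hpoly,
      intervalIntegral.integral_of_le hs, ← integral_Icc_eq_integral_Ioc,
      ofReal_integral_eq_lintegral_ofReal]
    · exact Continuous.integrableOn_Icc (by fun_prop)
    · refine (ae_restrict_iff' measurableSet_Icc).2 (Filter.Eventually.of_forall fun t ht => ?_)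
      have : 0 ≤ s - t := sub_nonneg.2 ht.2
      positivity
    · intro t ht
      simp only [Pi.mul_apply, gammaPDF_of_nonneg ht.1]
      rw [← ENNReal.ofReal_mul (by simp; positivity)]
      congr 1
      simp only [rpow_one, Gamma_one, div_one, sub_self, rpow_zero, mul_one, one_mul]
      rw [← mul_assoc, ← exp_add]
      congr 2
      ring
  -- The part t > s, where G = 1, contributes e^{-s}: the missing j = 0 term.
  rw [← lintegral_add_compl _ (measurableSet_Iic (a := s)), compl_Iic, hIic,
    setLIntegral_congr_fun measurableSet_Ioi (g := fun _ => 1)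
      (fun t ht => hneg _ (sub_neg.2 ht)), setLIntegral_one, hIoi, Finset.sum_range_succ',
    ← ENNReal.ofReal_add _ (exp_pos _).le]
  · simp [mul_add]
  · positivity

/-- The squared norm of a complex Gaussian vector has the tail of an Erlang distribution. -/
lemma pi_complexGaussian_lt_sum_normSq {v : ℝ≥0} (hv : v ≠ 0) (m : ℕ) {s : ℝ} (hs : 0 ≤ s) :
    Measure.pi (fun _ : Fin m => complexGaussian v) {w | s < ∑ i, ‖w i‖ ^ 2 / v} =
      ENNReal.ofReal (exp (-s) * ∑ j ∈ Finset.range m, s ^ j / j.factorial) := by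
  induction m generalizing s with
  | zero => simp [hs.not_gt]
  | succ m ih =>
    let G : ℝ → ENNReal := fun u =>
      Measure.pi (fun _ : Fin m => complexGaussian v) {w | u < ∑ i, ‖w i‖ ^ 2 / (v : ℝ)}
    -- Monotonicity gives the measurability of G needed for the change of variables.
    have hanti : Antitone G := fun u u' h => measure_mono fun w hw => h.trans_lt hw
    have hneg : ∀ u < 0, G u = 1 := by
      intro u hu
      have : {w : Fin m → ℂ | u < ∑ i, ‖w i‖ ^ 2 / (v : ℝ)} = univ :=
        eq_univ_of_forall fun w => hu.trans_le (by positivity)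
      simp only [G, this, measure_univ]
    have hpre : {w : Fin (m + 1) → ℂ | s < ∑ i, ‖w i‖ ^ 2 / (v : ℝ)} =
        MeasurableEquiv.piFinSuccAbove (fun _ => ℂ) 0 ⁻¹'
          {p : ℂ × (Fin m → ℂ) | s < ‖p.1‖ ^ 2 / (v : ℝ) + ∑ i, ‖p.2 i‖ ^ 2 / (v : ℝ)} := by
      ext w
      simp [Fin.sum_univ_succ, Fin.tail]
    rw [hpre, (measurePreserving_piFinSuccAbove (fun _ => complexGaussian v) 0).measure_preimage_equiv,
      Measure.prod_apply (measurableSet_lt measurable_const (by fun_prop)),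
      ← lintegral_expMeasure_tail hs hneg (fun u hu => ih hu), ← map_complexGaussian_normSq hv,
      lintegral_map (f := fun t => G (s - t))
        (hanti.measurable.comp (measurable_const.sub measurable_id)) (by fun_prop)]
    refine lintegral_congr fun z => congrArg _ ?_
    ext w
    simp [sub_lt_iff_lt_add']

/-- The closed event at s lies in the open event at every u < s; let u increase to s and use
continuity of the bound. Positivity of s leaves room for u > 0. -/
lemma pi_complexGaussian_le_sum_normSq {v : ℝ≥0} (hv : v ≠ 0) (m : ℕ) {s : ℝ} (hs : 0 < s) :
    Measure.pi (fun _ : Fin m => complexGaussian v) {w | s ≤ ∑ i, ‖w i‖ ^ 2 / v} ≤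
      ENNReal.ofReal (exp (-s) * ∑ j ∈ Finset.range m, s ^ j / j.factorial) := by
  have hcont : Continuous fun s : ℝ =>
      ENNReal.ofReal (exp (-s) * ∑ j ∈ Finset.range m, s ^ j / j.factorial) :=
    ENNReal.continuous_ofReal.comp (by fun_prop)
  refine ge_of_tendsto (hcont.continuousWithinAt (s := Iio s) (x := s)) ?_
  filter_upwards [Ioo_mem_nhdsLT hs] with u hu
  rw [← pi_complexGaussian_lt_sum_normSq hv m hu.1.le]
  exact measure_mono fun w hw => hu.2.trans_le hw

/-- The norm of a complex Gaussian vector reaches the threshold with small probability. -/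
lemma complexGaussianVector_threshold_le {m : ℕ} (hm : 2 ≤ m) {σ : ℝ} (hσ : 0 < σ) :
    complexGaussianVector m (Real.toNNReal (σ ^ 2)) {y | threshold m σ ≤ ‖y‖} ≤
      ENNReal.ofReal (√(2 / (π * log m))) := by
  have hv : Real.toNNReal (σ ^ 2) ≠ 0 := by
    rw [Ne, Real.toNNReal_eq_zero, not_le]
    positivity
  have ha : (0 : ℝ) < m + 1 / 2 * √(m * log m) := by positivity
  rw [complexGaussianVector, Measure.map_apply (WithLp.measurable_toLp 2 _)
    (measurableSet_le measurable_const measurable_norm)]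
  refine (measure_mono fun w hw => ?_).trans
    ((pi_complexGaussian_le_sum_normSq hv m ha).trans
      (ENNReal.ofReal_le_ofReal (exp_neg_mul_sum_le hm rfl)))
  have hw : threshold m σ ≤ ‖WithLp.toLp 2 w‖ := hw
  have h := pow_le_pow_left₀ (by unfold threshold; positivity) hw 2
  rw [EuclideanSpace.norm_sq_eq, threshold, mul_pow, sq_sqrt ha.le] at h
  rw [mem_ofPred_eq, ← Finset.sum_div, Real.coe_toNNReal _ (by positivity),
    le_div_iff₀ (by positivity), mul_comm]
  exact h

end Gaussian

end ComplexOMP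

/-! ### Combination of the two parts -/

theorem theorem4 {Ω : Type*} [MeasurableSpace Ω] (P : MeasureTheory.Measure Ω)
    [MeasureTheory.IsProbabilityMeasure P] (m n k : ℕ) (hm : 2 ≤ m)
    (Ψ : Matrix (Fin m) (Fin n) ℂ) (hΨ : ∀ j : Fin n, ‖ComplexOMP.atom Ψ j‖ = 1)
    (x : Fin n → ℂ) (hx : x ≠ 0) (hk : (ComplexOMP.supp x).card ≤ k)
    (σ : ℝ) (hσ : 0 < σ) (noise : Ω → EuclideanSpace ℂ (Fin m))
    (hnoise : ProbabilityTheory.HasLaw noise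
      (ComplexOMP.complexGaussianVector m (Real.toNNReal (σ ^ 2))) P)
    (hμ : ComplexOMP.mutualIncoherence Ψ < 1 / (2 * (k : ℝ) - 1))
    (hcoef : ∀ i : Fin n, x i ≠ 0 →
      2 * ComplexOMP.threshold m σ / (1 - (2 * (k : ℝ) - 1) * ComplexOMP.mutualIncoherence Ψ) ≤ ‖x i‖) :
    1 - √(2 / (Real.pi * Real.log (m : ℝ))) ≤
      P.real {ω : Ω | ComplexOMP.OMPSelects Ψ (ComplexOMP.measurement Ψ x (noise ω))
        (ComplexOMP.threshold m σ) (ComplexOMP.supp x)} := by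
  have hlarge : P.real {ω | ComplexOMP.threshold m σ ≤ ‖noise ω‖} ≤
      √(2 / (Real.pi * Real.log (m : ℝ))) := by
    refine ENNReal.toReal_le_of_le_ofReal (Real.sqrt_nonneg _) ?_
    rw [hnoise.measure_eq (p := fun y => ComplexOMP.threshold m σ ≤ ‖y‖)
      (measurableSet_le measurable_const measurable_norm)]
    exact ComplexOMP.complexGaussianVector_threshold_le hm hσ
  -- Success and large noise cover Ω. Subadditivity holds for arbitrary sets, so the success event
  -- need not be shown measurable.
  have hunion : {ω | ComplexOMP.OMPSelects Ψ (ComplexOMP.measurement Ψ x (noise ω))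
      (ComplexOMP.threshold m σ) (ComplexOMP.supp x)} ∪
      {ω | ComplexOMP.threshold m σ ≤ ‖noise ω‖} = Set.univ := by
    refine Set.eq_univ_of_forall fun ω => ?_
    rcases lt_or_ge ‖noise ω‖ (ComplexOMP.threshold m σ) with h | h
    · exact Or.inl (ComplexOMP.ompSelects_supp_of_norm_lt hΨ hx hk h hμ hcoef)
    · exact Or.inr h
  have hcover := MeasureTheory.measureReal_union_le (μ := P)
    {ω | ComplexOMP.OMPSelects Ψ (ComplexOMP.measurement Ψ x (noise ω))
      (ComplexOMP.threshold m σ) (ComplexOMP.supp x)}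
    {ω | ComplexOMP.threshold m σ ≤ ‖noise ω‖}
  rw [hunion, MeasureTheory.probReal_univ] at hcover
  linarith
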